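/- For a finite group $G$, the commuting graph $\mathcal{C}(G)$ is the simple graph whose vertices are the elements of $G$, two distinct elements being adjacent exactly when they commute, and $\kappa(G)$ denotes the number of spanning trees of $\mathcal{C}(G)$. For a prime power $q$, let $L_2(q)=\mathrm{PSL}(2,q)$ be the quotient of $\mathrm{SL}(2,\mathbb{F}_q)$ by its center. Let $q=2^n$, where $n\geq 2$ is a natural number. Then $$\kappa(L_2(q))=q^{(q-2)(q+1)}\,(q-1)^{(q-3)q(q+1)/2}\,(q+1)^{(q-1)^2q/2}.$$ In particular, $L_2(4)\cong L_2(5)\cong \mathbb{A}_5$, where $\mathbb{A}_5$ is the alternating group on five letters, and $$\kappa(L_2(5))=\kappa(\mathbb{A}_5)=2^{20}\cdot 3^{10}\cdot 5^{18}.$$ -/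

import Mathlib

/-- The commuting graph of a group `G`: the vertices are the elements of `G`, and two distinct
elements are adjacent exactly when they commute. -/
def commutingGraph (G : Type*) [Group G] : SimpleGraph G where
  Adj x y := x ≠ y ∧ Commute x y
  symm := ⟨fun _ _ h => ⟨h.1.symm, h.2.symm⟩⟩
  loopless := ⟨fun _ h => h.1 rfl⟩

/-- The number of spanning trees of a graph on a finite vertex set (trees on the whole vertex set,
all of whose edges are edges of `Γ`). -/
noncomputable def SimpleGraph.treeNumber {V : Type*} (Γ : SimpleGraph V) : ℕ :=
  {T : SimpleGraph V | T ≤ Γ ∧ T.IsTree}.ncard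

/-- `κ(G)`: the number of spanning trees of the commuting graph of a finite group `G`. -/
noncomputable def commutingTreeNumber (G : Type*) [Group G] : ℕ :=
  (commutingGraph G).treeNumber

/-- `L₂(q)`, the projective special linear group `PSL(2, F)` over a field `F` (with `q` elements),
that is, the quotient of `SL(2, F)` by its center. -/
abbrev LTwo (F : Type*) [Field F] : Type _ :=
  Matrix.ProjectiveSpecialLinearGroup (Fin 2) F

-- In `SL(2, q)` with `q` even, distinct from `PSL(2, q)` only in name because the centre is
-- trivial, commuting is transitive on nonidentity elements. The commuting graph is therefore a
-- family of complete graphs, one for each centralizer of a nonidentity element, glued together at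
-- the vertex `1`. A spanning tree of such a wedge is an independent choice of spanning trees of the
-- pieces, so Cayley's formula gives a factor `m ^ (m - 2)` for each centralizer of order `m`
-- (`treeNumber_wedge`, `commutingTreeNumber_eq_prod`).
--
-- It remains to count centralizers. If `x ≠ 1` has trace `τ`, its centralizer is the norm-one group
-- of `F[x]`, of order `q + 1 - r`, where `r` is the number of roots of `X² - τ X + 1`
-- (`card_centralizer_add_numRoots`). There are `q (q - 1 + r)` matrices of trace `τ`. The value `r
-- = 1` occurs only for `τ = 0`, `r = 2` for `(q - 2) / 2` traces and `r = 0` for `q / 2`. This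
-- yields `q + 1` centralizers of order `q`, `q (q + 1) / 2` of order `q - 1` and `q (q - 1) / 2` of
-- order `q + 1`.
--
-- For the isomorphisms with the alternating group, a group of order 60 acting faithfully on five
-- points has index two in the symmetric group. The points are the projective line over the field of
-- order 4, and the cosets of the binary tetrahedral group in `SL(2, 5)`.

universe u

/-! ### Cayley's formula for rooted forests -/

/-- A parent function `f : α → α ⊕ β` is a rooted forest on the vertex set `α ⊕ β` with set of
roots `β` if following parents never goes on forever. -/
def IsRootedForest {α β : Type*} (f : α → α ⊕ β) : Prop :=
  WellFounded fun b a => f a = Sum.inl b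

/-- The number of rooted forests with `n` non-root vertices and `k` prescribed roots. -/
def rootedForestNumber : ℕ → ℕ → ℕ
  | 0, _ => 1
  | n + 1, k => k * (n + 1 + k) ^ n

/-- The factor `i + 1` in the forest number is absorbed by `(m + 1) * m.choose i = (m + 1).choose (i
+ 1) * (i + 1)`. -/
theorem choose_mul_rootedForestNumber {m i : ℕ} (hi : i ≤ m) :
    (m + 1).choose (i + 1) * rootedForestNumber (m - i) (i + 1)
      = m.choose i * (m + 1) ^ (m - i) := by
  obtain ⟨j, rfl⟩ := Nat.exists_eq_add_of_le hi
  rw [Nat.add_sub_cancel_left]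
  cases j with
  | zero => simp [rootedForestNumber]
  | succ j =>
    have h := Nat.add_one_mul_choose_eq (i + (j + 1)) i
    simp only [rootedForestNumber]
    rw [← mul_assoc, ← h, pow_succ, show j + 1 + (i + 1) = i + (j + 1) + 1 by ring]
    ring

/-- The binomial expansion of `k * (k + (m + 1)) ^ m`, shifted by one index. It mirrors the
classification of forests by the set of `i` children of the roots, which become the roots of what
remains. -/
theorem rootedForestNumber_eq_sum (n k : ℕ) :
    rootedForestNumber n k
      = ∑ i ∈ Finset.range (n + 1), n.choose i * (k ^ i * rootedForestNumber (n - i) i) := by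
  cases n with
  | zero => simp [rootedForestNumber]
  | succ m =>
    rw [Finset.sum_range_succ']
    have h0 : rootedForestNumber (m + 1 - 0) 0 = 0 := by simp [rootedForestNumber]
    rw [h0, mul_zero, mul_zero, add_zero, rootedForestNumber, add_comm (m + 1) k, add_pow,
      Finset.mul_sum]
    refine Finset.sum_congr rfl fun i hi => ?_
    have h := choose_mul_rootedForestNumber (Nat.lt_succ_iff.mp (Finset.mem_range.mp hi))
    rw [Nat.add_sub_add_right, mul_left_comm ((m + 1).choose (i + 1)), h, Nat.cast_id]
    ring

section layer

variable {α β : Type*} (S : Finset α)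

/-- The rooted forest in which `S` is the set of children of the roots, with parents given by `h`
on `S`, and by the forest `g` with set of roots `S` off `S`. -/
def graftForest [DecidableEq α] (p : (S → β) × ({a // a ∉ S} → {a // a ∉ S} ⊕ S)) (a : α) : α ⊕ β :=
  if ha : a ∈ S then .inr (p.1 ⟨a, ha⟩)
  else .inl ((p.2 ⟨a, ha⟩).elim Subtype.val Subtype.val)

theorem graftForest_injective [DecidableEq α] :
    Function.Injective (graftForest (β := β) S) := by
  rintro ⟨h, g⟩ ⟨h', g'⟩ e
  refine Prod.ext (funext fun a => ?_) (funext fun a => ?_)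
  · have := congrFun e a
    simpa [graftForest] using this
  · have := congrFun e a
    simp only [graftForest, a.2, dite_false, Sum.inl.injEq] at this
    revert this
    change Sum.elim _ _ (g a) = Sum.elim _ _ (g' a) → g a = g' a
    rcases g a with x | x <;> rcases g' a with y | y <;> intro this <;>
      simp only [Sum.elim_inl, Sum.elim_inr] at this
    · exact congrArg Sum.inl (Subtype.ext this)
    · exact absurd y.2 (this ▸ x.2)
    · exact absurd x.2 (this ▸ y.2)
    · exact congrArg Sum.inr (Subtype.ext this)

/-- Vertices of `S` have no non-root parent, so they are accessible at once; termination then only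
concerns the vertices off `S`. -/
theorem isRootedForest_graftForest [DecidableEq α]
    (p : (S → β) × ({a // a ∉ S} → {a // a ∉ S} ⊕ S)) :
    IsRootedForest (graftForest S p) ↔ IsRootedForest p.2 := by
  constructor
  · intro h
    refine Subrelation.wf ?_ (InvImage.wf Subtype.val h)
    intro b a hab
    simp [InvImage, graftForest, a.2, hab]
  · intro h
    have hS : ∀ a ∈ S, Acc (fun b a => graftForest S p a = Sum.inl b) a := fun a ha =>
      ⟨a, fun b hb => by simp [graftForest, ha] at hb⟩
    have hS' : ∀ a : {a // a ∉ S}, Acc (fun b a => graftForest S p a = Sum.inl b) a.1 := by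
      intro a
      induction a using h.induction with
      | _ a ih =>
        refine ⟨_, fun b hb => ?_⟩
        simp only [graftForest, a.2, dite_false, Sum.inl.injEq] at hb
        rcases hg : p.2 a with x | x
        · rw [hg] at hb
          exact hb ▸ ih x hg
        · rw [hg] at hb
          exact hb ▸ hS _ x.2
    exact ⟨fun a => if ha : a ∈ S then hS a ha else hS' ⟨a, ha⟩⟩

theorem exists_graftForest_eq [DecidableEq α] (f : α → α ⊕ β)
    (hf : ∀ a, a ∈ S ↔ (f a).isRight) : ∃ p, graftForest S p = f := by
  have h1 : ∀ a : S, ∃ b, f a = Sum.inr b := fun a => Sum.isRight_iff.mp ((hf a).mp a.2)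
  have h2 : ∀ a : {a // a ∉ S}, ∃ y : {a // a ∉ S} ⊕ S,
      f a = Sum.inl (y.elim Subtype.val Subtype.val) := by
    intro a
    obtain ⟨b, hb⟩ := Sum.isLeft_iff.mp (by simpa using (hf a).not.mp a.2)
    by_cases hbS : b ∈ S
    · exact ⟨.inr ⟨b, hbS⟩, hb⟩
    · exact ⟨.inl ⟨b, hbS⟩, hb⟩
  choose h hh using h1
  choose g hg using h2
  refine ⟨(h, g), funext fun a => ?_⟩
  by_cases ha : a ∈ S
  · simp [graftForest, ha, ← hh ⟨a, ha⟩]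
  · simp only [graftForest, ha, dite_false]
    exact (hg ⟨a, ha⟩).symm

/-- The rooted forests in which `S` is the set of children of the roots. -/
noncomputable def graftForestEquiv :
    (S → β) × {g : {a // a ∉ S} → {a // a ∉ S} ⊕ S // IsRootedForest g} ≃
      {f : {f : α → α ⊕ β // IsRootedForest f} // ∀ a, a ∈ S ↔ (f.1 a).isRight} := by
  classical
  refine Equiv.ofBijective (fun p => ⟨⟨graftForest S (p.1, p.2.1),
    (isRootedForest_graftForest S _).mpr p.2.2⟩, fun a => ?_⟩) ⟨?_, ?_⟩
  · by_cases ha : a ∈ S <;> simp [graftForest, ha]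
  · intro p p' e
    have := graftForest_injective S (congrArg (fun f => f.1.1) e)
    simp only [Prod.mk.injEq] at this
    exact Prod.ext this.1 (Subtype.ext this.2)
  · rintro ⟨⟨f, hf⟩, hfS⟩
    obtain ⟨p, rfl⟩ := exists_graftForest_eq S f hfS
    exact ⟨(p.1, ⟨p.2, (isRootedForest_graftForest S p).mp hf⟩), rfl⟩

end layer

theorem isEmpty_isRootedForest {α β : Type*} [Nonempty α] [IsEmpty β] :
    IsEmpty {f : α → α ⊕ β // IsRootedForest f} := by
  refine ⟨fun ⟨f, hf⟩ => ?_⟩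
  obtain ⟨a, -, ha⟩ := hf.has_min Set.univ Set.univ_nonempty
  rcases h : f a with b | b
  · exact ha b trivial h
  · exact isEmptyElim b

theorem card_isRootedForest_eq_sum (α β : Type*) [Fintype α] [Finite β] :
    Nat.card {f : α → α ⊕ β // IsRootedForest f} = ∑ S : Finset α,
      Nat.card β ^ S.card *
        Nat.card {g : {a // a ∉ S} → {a // a ∉ S} ⊕ S // IsRootedForest g} := by
  classical
  let level : {f : α → α ⊕ β // IsRootedForest f} → Finset α :=
    fun f => Finset.univ.filter fun a => (f.1 a).isRight
  rw [← Nat.card_congr (Equiv.sigmaFiberEquiv level), Nat.card_sigma]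
  refine Finset.sum_congr rfl fun S _ => ?_
  have e : {f // level f = S} ≃
      {f : {f : α → α ⊕ β // IsRootedForest f} // ∀ a, a ∈ S ↔ (f.1 a).isRight} :=
    Equiv.subtypeEquivRight fun f => by
      simp [level, Finset.ext_iff, iff_comm]
  rw [Nat.card_congr e, ← Nat.card_congr (graftForestEquiv S), Nat.card_prod, Nat.card_fun,
    Nat.card_eq_fintype_card (α := S), Fintype.card_coe]

/-- **Cayley's formula** for rooted forests. -/
theorem card_isRootedForest (α β : Type u) [Finite α] [Finite β] :
    Nat.card {f : α → α ⊕ β // IsRootedForest f}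
      = rootedForestNumber (Nat.card α) (Nat.card β) := by
  classical
  induction h : Nat.card α using Nat.strong_induction_on generalizing α β with
  | _ n ih =>
    have := Fintype.ofFinite α
    rw [card_isRootedForest_eq_sum, rootedForestNumber_eq_sum]
    have key : ∀ S : Finset α, Nat.card {g : {a // a ∉ S} → {a // a ∉ S} ⊕ S // IsRootedForest g}
        = rootedForestNumber (n - S.card) S.card := by
      intro S
      have hS : Nat.card {a // a ∉ S} = n - S.card := by
        rw [Nat.card_eq_fintype_card, Fintype.card_subtype_compl, ← h, Nat.card_eq_fintype_card,
          Fintype.card_coe]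
      -- With `S` empty there is no smaller instance to appeal to: without roots there is one forest
      -- on no vertices and none otherwise, in agreement with `rootedForestNumber n 0`.
      rcases S.eq_empty_or_nonempty with rfl | hne
      · rcases isEmpty_or_nonempty α with hα | hα
        · have hn : n = 0 := by rw [← h]; exact Nat.card_of_isEmpty
          subst hn
          have : Unique {g : {a // a ∉ (∅ : Finset α)} → {a // a ∉ (∅ : Finset α)} ⊕
              (∅ : Finset α) // IsRootedForest g} :=
            ⟨⟨⟨isEmptyElim, ⟨isEmptyElim⟩⟩⟩, fun _ => Subsingleton.elim _ _⟩
          simp [rootedForestNumber]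
        · have : Nonempty {a // a ∉ (∅ : Finset α)} := ⟨⟨hα.some, by simp⟩⟩
          have := isEmpty_isRootedForest (α := {a // a ∉ (∅ : Finset α)}) (β := (∅ : Finset α))
          obtain ⟨m, hm⟩ := Nat.exists_eq_add_one.mpr (h ▸ Nat.card_pos (α := α))
          rw [Nat.card_of_isEmpty, hm]
          simp [rootedForestNumber]
      · have hpos := hne.card_pos
        have hle : S.card ≤ n := by
          rw [← h, Nat.card_eq_fintype_card]; exact S.card_le_univ
        rw [ih (n - S.card) (by omega) _ _ hS, Nat.card_eq_fintype_card, Fintype.card_coe]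
    simp_rw [key]
    have hsum := Finset.sum_powerset_apply_card (x := (Finset.univ : Finset α))
      (fun i => Nat.card β ^ i * rootedForestNumber (n - i) i)
    rw [Finset.powerset_univ, Finset.card_univ, ← Nat.card_eq_fintype_card, h] at hsum
    simpa using hsum

/-- The number of rooted trees with `n` non-root vertices and a prescribed root. -/
theorem card_isRootedForest_punit (α : Type u) [Finite α] :
    Nat.card {f : α → α ⊕ PUnit.{u + 1} // IsRootedForest f}
      = (Nat.card α + 1) ^ (Nat.card α - 1) := by
  rw [card_isRootedForest]
  cases Nat.card α <;> simp [rootedForestNumber]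

/-! ### Spanning trees as parent functions -/

/-- The graph in which every non-root vertex is joined to its parent. -/
def parentGraph {α β : Type*} (f : α → α ⊕ β) : SimpleGraph (α ⊕ β) :=
  SimpleGraph.fromEdgeSet (Set.range fun a => s(Sum.inl a, f a))

section tree

variable {α β : Type*} {f : α → α ⊕ β}

theorem IsRootedForest.ne_inl (hf : IsRootedForest f) (a : α) :
    f a ≠ Sum.inl a := fun h => (hf.irrefl).irrefl a h

theorem IsRootedForest.parentGraph_adj (hf : IsRootedForest f)
    (a : α) : (parentGraph f).Adj (Sum.inl a) (f a) := by
  rw [parentGraph, SimpleGraph.fromEdgeSet_adj]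
  exact ⟨⟨a, rfl⟩, (hf.ne_inl a).symm⟩

/-- Following parents, one proves a property of all vertices from the roots on. -/
theorem IsRootedForest.vertex_induction (hf : IsRootedForest f)
    {P : α ⊕ β → Prop} (hr : ∀ b, P (Sum.inr b)) (hs : ∀ a, P (f a) → P (Sum.inl a))
    (x : α ⊕ β) : P x := by
  rcases x with a | b
  · refine WellFounded.induction (C := fun a => P (Sum.inl a)) hf a fun a ih => hs a ?_
    rcases h : f a with b | b
    · exact ih b h
    · exact hr b
  · exact hr b

theorem parentGraph_le {Γ : SimpleGraph (α ⊕ β)} (h : ∀ a, Γ.Adj (Sum.inl a) (f a)) :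
    parentGraph f ≤ Γ := by
  rw [parentGraph, SimpleGraph.fromEdgeSet_le]
  rintro _ ⟨⟨a, rfl⟩, -⟩
  exact h a

theorem isRootedForest_of_lt (d : α ⊕ β → ℕ) (h : ∀ a, d (f a) < d (Sum.inl a)) :
    IsRootedForest f := by
  refine Subrelation.wf ?_ (InvImage.wf (fun a => d (Sum.inl a)) wellFounded_lt)
  intro b a hab
  change d (Sum.inl b) < d (Sum.inl a)
  rw [← hab]
  exact h a

/-- Each edge from `a` to `g a` is also an edge of `f`, possibly traversed the other way. A reversed
edge is impossible: by induction from the root, `f` and `g` agree at the parent `b`, and then `a`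
and `b` would be parents of each other under `g`. -/
theorem IsRootedForest.eq_of_parentGraph_eq {f g : α → α ⊕ β} (hg : IsRootedForest g)
    (h : parentGraph f = parentGraph g) : f = g := by
  have hgf : ∀ a, g a = f a ∨ ∃ b, g a = Sum.inl b ∧ f b = Sum.inl a := by
    intro a
    have := hg.parentGraph_adj a
    rw [← h, parentGraph, SimpleGraph.fromEdgeSet_adj] at this
    obtain ⟨⟨b, hb⟩, -⟩ := this
    rcases Sym2.eq_iff.mp hb with ⟨h1, h2⟩ | ⟨h1, h2⟩
    · exact .inl (by rw [← h2, Sum.inl.inj h1])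
    · exact .inr ⟨b, h1.symm, h2⟩
  funext a
  refine WellFounded.induction (C := fun a => f a = g a) hg a fun a ih => ?_
  rcases hgf a with h' | ⟨b, hb, hb'⟩
  · exact h'.symm
  · exfalso
    have h2 := ih b hb
    rw [hb'] at h2
    exact WellFounded.asymmetric hg _ _ hb h2.symm

variable {f : α → α ⊕ PUnit.{u + 1}}

/-- Every vertex reaches the root, and there are at most `Nat.card α` edges on one more vertex, the
fewest a connected graph can have. -/
theorem IsRootedForest.isTree_parentGraph [Finite α] (hf : IsRootedForest f) :
    (parentGraph f).IsTree := by
  have hc : (parentGraph f).Connected := by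
    rw [SimpleGraph.connected_iff_exists_forall_reachable]
    exact ⟨Sum.inr PUnit.unit, hf.vertex_induction
      (fun _ => SimpleGraph.Reachable.refl _)
      fun a h => h.trans (hf.parentGraph_adj a).symm.reachable⟩
  rw [SimpleGraph.isTree_iff_connected_and_card]
  refine ⟨hc, le_antisymm ?_ hc.card_vert_le_card_edgeSet_add_one⟩
  rw [Nat.card_sum, Nat.card_unique (α := PUnit)]
  refine Nat.add_le_add_right ?_ 1
  calc Nat.card (parentGraph f).edgeSet
      ≤ Nat.card (Set.range fun a => s(Sum.inl a, f a)) := by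
        refine Nat.card_mono (Set.toFinite _) ?_
        rw [parentGraph, SimpleGraph.edgeSet_fromEdgeSet]
        exact Set.sdiff_subset
    _ ≤ Nat.card α := Finite.card_range_le _

/-- The parent of `a` is the last vertex before `a` on a shortest walk from the root, so distance to
the root decreases. The resulting parent graph is connected and lies in `T`, and a tree is minimal
among connected graphs. -/
theorem exists_parentGraph_eq [Finite α] {T : SimpleGraph (α ⊕ PUnit.{u + 1})} (hT : T.IsTree) :
    ∃ f : α → α ⊕ PUnit.{u + 1}, IsRootedForest f ∧ (∀ a, T.Adj (Sum.inl a) (f a)) ∧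
      parentGraph f = T := by
  let r : α ⊕ PUnit.{u + 1} := Sum.inr PUnit.unit
  have h : ∀ a : α, ∃ y, T.Adj (Sum.inl a) y ∧ T.dist r y < T.dist r (Sum.inl a) := by
    intro a
    obtain ⟨p, hp⟩ := hT.connected.exists_walk_length_eq_dist r (Sum.inl a)
    have hnil : ¬ p.Nil := fun h => Sum.inr_ne_inl h.eq
    refine ⟨p.penultimate, (p.adj_penultimate hnil).symm, ?_⟩
    have h1 := SimpleGraph.dist_le p.dropLast
    have h2 : p.dropLast.length + 1 = p.length := p.length_dropLast_add_one hnil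
    omega
  choose f hadj hlt using h
  have hf : IsRootedForest f := isRootedForest_of_lt _ hlt
  refine ⟨f, hf, hadj, ?_⟩
  exact le_antisymm (parentGraph_le hadj)
    ((SimpleGraph.isTree_iff_minimal_connected.mp hT).2 hf.isTree_parentGraph.connected
      (parentGraph_le hadj))

/-- Spanning trees correspond to parent functions with respect to a root. -/
theorem treeNumber_eq_card_isRootedForest [Finite α] (Γ : SimpleGraph (α ⊕ PUnit.{u + 1})) :
    Γ.treeNumber = Nat.card {f : α → α ⊕ PUnit.{u + 1} //
      IsRootedForest f ∧ ∀ a, Γ.Adj (Sum.inl a) (f a)} := by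
  rw [SimpleGraph.treeNumber, ← Nat.card_coe_set_eq]
  refine (Nat.card_congr (Equiv.ofBijective (fun f => ⟨parentGraph f.1, parentGraph_le f.2.2,
    f.2.1.isTree_parentGraph⟩) ⟨fun f g h => ?_, fun T => ?_⟩)).symm
  · exact Subtype.ext (g.2.1.eq_of_parentGraph_eq (congrArg Subtype.val h))
  · obtain ⟨f, hf, hadj, h⟩ := exists_parentGraph_eq T.2.2
    exact ⟨⟨f, hf, fun a => T.2.1 (hadj a)⟩, Subtype.ext h⟩

end tree

theorem SimpleGraph.Iso.treeNumber_eq {V W : Type*} {Γ : SimpleGraph V} {Δ : SimpleGraph W}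
    (e : Γ ≃g Δ) : Γ.treeNumber = Δ.treeNumber := by
  refine Set.ncard_congr (fun T _ => T.comap e.symm) ?_ ?_ ?_
  · rintro T ⟨hT, hT'⟩
    refine ⟨fun x y h => ?_, ?_⟩
    · exact e.symm.map_rel_iff.mp (hT h)
    · exact (SimpleGraph.Iso.comap e.symm.toEquiv T).isTree_iff.mpr hT'
  · intro T T' _ _ h
    ext x y
    have := congrArg (fun G => G.Adj (e x) (e y)) h
    simpa using this
  · rintro T ⟨hT, hT'⟩
    refine ⟨T.comap e, ⟨fun x y h => e.map_rel_iff.mp (hT h),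
      (SimpleGraph.Iso.comap e.toEquiv T).isTree_iff.mpr hT'⟩, ?_⟩
    ext x y
    simp

/-! ### Complete graphs glued at one vertex -/

section wedge

variable {α : Type u} {ι : Type*} (c : α → ι)

/-- The forest on `α ⊕ PUnit` glued from forests on the fibres of `c`. -/
def glueForest (g : ∀ i, {a // c a = i} → {a // c a = i} ⊕ PUnit.{u + 1}) (a : α) :
    α ⊕ PUnit.{u + 1} :=
  (g (c a) ⟨a, rfl⟩).map Subtype.val id

theorem glueForest_apply (g : ∀ i, {a // c a = i} → {a // c a = i} ⊕ PUnit.{u + 1}) (i : ι)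
    (a : {a // c a = i}) : glueForest c g a = (g i a).map Subtype.val id := by
  obtain ⟨a, rfl⟩ := a
  rfl

theorem glueForest_injective : Function.Injective (glueForest c) := by
  intro g g' h
  funext i a
  have := congrFun h a
  rw [glueForest_apply, glueForest_apply] at this
  exact Sum.map_injective.mpr ⟨Subtype.val_injective, Function.injective_id⟩ this

theorem eq_of_glueForest_eq_inl {g : ∀ i, {a // c a = i} → {a // c a = i} ⊕ PUnit.{u + 1}}
    {a b : α} (h : glueForest c g a = Sum.inl b) : c b = c a := by
  rw [glueForest] at h
  rcases hg : g (c a) ⟨a, rfl⟩ with x | x <;> rw [hg] at h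
  · have := Sum.inl.inj h
    rw [← this, x.2]
  · cases h

theorem isRootedForest_glueForest
    (g : ∀ i, {a // c a = i} → {a // c a = i} ⊕ PUnit.{u + 1}) :
    IsRootedForest (glueForest c g) ↔ ∀ i, IsRootedForest (g i) := by
  constructor
  · intro h i
    refine Subrelation.wf ?_ (InvImage.wf Subtype.val h)
    intro b a hab
    change glueForest c g a = _
    rw [glueForest_apply, hab]
    rfl
  · intro h
    have key : ∀ i, ∀ a : {a // c a = i},
        Acc (fun b a => glueForest c g a = Sum.inl b) a.1 := by
      intro i a
      induction a using (h i).induction with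
      | _ a ih =>
        refine ⟨_, fun b hb => ?_⟩
        rw [glueForest_apply] at hb
        rcases hg : g i a with x | x <;> rw [hg] at hb
        · have := Sum.inl.inj hb
          exact this ▸ ih x hg
        · cases hb
    exact ⟨fun a => key _ ⟨a, rfl⟩⟩

theorem exists_glueForest_eq (f : α → α ⊕ PUnit.{u + 1})
    (hf : ∀ a b, f a = Sum.inl b → c b = c a) : ∃ g, glueForest c g = f := by
  have h : ∀ i (a : {a // c a = i}), ∃ y : {a // c a = i} ⊕ PUnit.{u + 1},
      f a = y.map Subtype.val id := by
    rintro i ⟨a, rfl⟩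
    rcases h : f a with b | b
    · exact ⟨.inl ⟨b, hf a b h⟩, rfl⟩
    · exact ⟨.inr b, rfl⟩
  choose g hg using h
  exact ⟨g, funext fun a => (hg _ ⟨a, rfl⟩).symm⟩

/-- The number of spanning trees of a family of complete graphs glued together at one vertex. -/
theorem treeNumber_wedge [Finite α] [Fintype ι] (Γ : SimpleGraph (α ⊕ PUnit.{u + 1}))
    (hr : ∀ a b, Γ.Adj (Sum.inl a) (Sum.inr b))
    (hΓ : ∀ a b, Γ.Adj (Sum.inl a) (Sum.inl b) ↔ a ≠ b ∧ c a = c b) :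
    Γ.treeNumber = ∏ i, (Nat.card {a // c a = i} + 1) ^ (Nat.card {a // c a = i} - 1) := by
  rw [treeNumber_eq_card_isRootedForest]
  simp_rw [← card_isRootedForest_punit]
  rw [← Nat.card_pi]
  have hadj (g : ∀ i, {g : {a // c a = i} → {a // c a = i} ⊕ PUnit.{u + 1} //
      IsRootedForest g}) (a : α) : Γ.Adj (Sum.inl a) (glueForest c (fun i => (g i).1) a) := by
    have hf := (isRootedForest_glueForest c _).mpr fun i => (g i).2
    rcases h : glueForest c (fun i => (g i).1) a with b | b
    · refine (hΓ a b).mpr ⟨?_, (eq_of_glueForest_eq_inl c h).symm⟩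
      rintro rfl
      exact hf.ne_inl a h
    · exact hr a b
  refine (Nat.card_congr (Equiv.ofBijective (fun g => ⟨glueForest c fun i => (g i).1,
    (isRootedForest_glueForest c _).mpr fun i => (g i).2, hadj g⟩) ⟨?_, ?_⟩)).symm
  · intro g g' h
    have : (fun i => (g i).1) = fun i => (g' i).1 :=
      glueForest_injective c (congrArg Subtype.val h)
    exact funext fun i => Subtype.ext (congrFun this i)
  · rintro ⟨f, hf, hfΓ⟩
    obtain ⟨g, rfl⟩ := exists_glueForest_eq c f fun a b h => by
      have := hfΓ a
      rw [h, hΓ] at this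
      exact this.2.symm
    exact ⟨fun i => ⟨g i, (isRootedForest_glueForest c g).mp hf i⟩, rfl⟩

end wedge

/-! ### Groups with transitive commuting relation -/

theorem card_ne_add_one {X : Type*} [Finite X] (x : X) :
    Nat.card {y // y ≠ x} + 1 = Nat.card X := by
  classical
  rw [← Finite.card_option, Nat.card_congr (Equiv.optionSubtypeNe x)]

section group

variable {G : Type u} [Group G]

/-- The commuting relation on the nonidentity elements of a group in which it is transitive. -/
def commuteSetoid
    (h : ∀ x y z : G, y ≠ 1 → Commute x y → Commute y z → Commute x z) :
    Setoid {x : G // x ≠ 1} where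
  r x y := Commute x.1 y.1
  iseqv := ⟨fun x => Commute.refl x.1, fun h => h.symm, fun {x y z} h₁ h₂ => h x y z y.2 h₁ h₂⟩

theorem card_commute_add_one [Finite G] (x : G) :
    Nat.card {y : {y : G // y ≠ 1} // Commute y.1 x} + 1
      = Nat.card (Subgroup.centralizer {x}) := by
  rw [← card_ne_add_one (1 : Subgroup.centralizer {x})]
  refine congrArg (· + 1) (Nat.card_congr ⟨fun y => ⟨⟨y.1.1, ?_⟩, ?_⟩,
    fun y => ⟨⟨y.1.1, ?_⟩, ?_⟩, fun _ => rfl, fun _ => rfl⟩)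
  · exact Subgroup.mem_centralizer_singleton_iff.mpr y.2
  · exact fun h => y.1.2 (congrArg Subtype.val h)
  · exact fun h => y.2 (Subtype.ext h)
  · exact Subgroup.mem_centralizer_singleton_iff.mp y.1.2

/-- The element `1` is joined to all others in the commuting graph. -/
noncomputable def nonidentitySumEquiv : {x : G // x ≠ 1} ⊕ PUnit.{u + 1} ≃ G :=
  Equiv.ofBijective (Sum.elim Subtype.val fun _ => 1) <| by
    constructor
    · rintro (x | x) (y | y) h
      · exact congrArg Sum.inl (Subtype.ext h)
      · exact absurd h x.2
      · exact absurd h.symm y.2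
      · rfl
    · intro x
      by_cases hx : x = 1
      · exact ⟨.inr PUnit.unit, hx.symm⟩
      · exact ⟨.inl ⟨x, hx⟩, rfl⟩

theorem commutingTreeNumber_eq_prod_quotient [Finite G]
    (h : ∀ x y z : G, y ≠ 1 → Commute x y → Commute y z → Commute x z)
    [Fintype (Quotient (commuteSetoid h))] :
    commutingTreeNumber G = ∏ i : Quotient (commuteSetoid h),
      (Nat.card {x // Quotient.mk (commuteSetoid h) x = i} + 1) ^
        (Nat.card {x // Quotient.mk (commuteSetoid h) x = i} - 1) := by
  rw [commutingTreeNumber,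
    ← (SimpleGraph.Iso.comap nonidentitySumEquiv (commutingGraph G)).treeNumber_eq]
  refine treeNumber_wedge _ _ (fun a b => ?_) fun a b => ?_
  · exact ⟨a.2, Commute.one_right _⟩
  · rw [Quotient.eq, ne_eq, ← Subtype.coe_inj]
    exact Iff.rfl

/-- The number of spanning trees of the commuting graph of a finite group in which the
centralizers of nonidentity elements are abelian. -/
theorem commutingTreeNumber_eq_prod [Finite G]
    (h : ∀ x y z : G, y ≠ 1 → Commute x y → Commute y z → Commute x z) (s : Finset ℕ)
    (hs : ∀ x : G, x ≠ 1 → Nat.card (Subgroup.centralizer {x}) ∈ s) :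
    commutingTreeNumber G = ∏ m ∈ s, m ^ ((m - 2) *
      (Nat.card {x : {x : G // x ≠ 1} // Nat.card (Subgroup.centralizer {x.1}) = m} / (m - 1))) := by
  classical
  have := Fintype.ofFinite (Quotient (commuteSetoid h))
  rw [commutingTreeNumber_eq_prod_quotient h]
  let size : Quotient (commuteSetoid h) → ℕ := fun i =>
    Nat.card {x // Quotient.mk (commuteSetoid h) x = i} + 1
  have hsize : ∀ x, size (Quotient.mk _ x) = Nat.card (Subgroup.centralizer {x.1}) := by
    intro x
    rw [← card_commute_add_one]
    exact congrArg (· + 1) (Nat.card_congr (Equiv.subtypeEquivRight fun y => Quotient.eq))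
  have hmem : ∀ i ∈ Finset.univ, size i ∈ s := by
    intro i _
    induction i using Quotient.inductionOn with
    | _ x => exact hsize x ▸ hs x.1 x.2
  have hpos : ∀ i, 1 < size i := by
    intro i
    induction i using Quotient.inductionOn with
    | _ x =>
      have : Nonempty {y // Quotient.mk (commuteSetoid h) y = Quotient.mk _ x} := ⟨⟨x, rfl⟩⟩
      exact Nat.lt_add_of_pos_left Nat.card_pos
  rw [← Finset.prod_fiberwise_of_maps_to hmem]
  refine Finset.prod_congr rfl fun m _ => ?_
  have hcard : Nat.card {x : {x : G // x ≠ 1} // Nat.card (Subgroup.centralizer {x.1}) = m}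
      = (Finset.univ.filter fun i => size i = m).card * (m - 1) := by
    have e : {x : {x : G // x ≠ 1} // Nat.card (Subgroup.centralizer {x.1}) = m} ≃
        Σ i : {i // size i = m}, {x // Quotient.mk (commuteSetoid h) x = i.1} :=
      ⟨fun x => ⟨⟨Quotient.mk _ x.1, (hsize x.1).trans x.2⟩, ⟨x.1, rfl⟩⟩,
        fun p => ⟨p.2.1, by rw [← hsize, p.2.2, p.1.2]⟩, fun _ => rfl,
        by rintro ⟨⟨i, hi⟩, ⟨x, hx⟩⟩; change _ = i at hx; subst hx; rfl⟩
    rw [Nat.card_congr e, Nat.card_sigma, ← Fintype.card_subtype, ← Finset.card_univ]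
    refine Finset.sum_const_nat fun i _ => ?_
    exact (Nat.sub_eq_of_eq_add i.2.symm).symm
  calc _ = ∏ i ∈ Finset.univ.filter (fun i => size i = m), m ^ (m - 2) := by
        refine Finset.prod_congr rfl fun i hi => ?_
        have := (Finset.mem_filter.mp hi).2
        rw [← this]
        rfl
    _ = _ := by
        rw [Finset.prod_const, ← pow_mul, hcard]
        -- If no class has this size, `m - 1` may be zero, but both exponents vanish; otherwise `1 <
        -- m` and the division is exact.
        rcases (Finset.univ.filter fun i => size i = m).eq_empty_or_nonempty with h0 | ⟨i, hi⟩
        · rw [h0, Finset.card_empty, zero_mul, Nat.zero_div]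
        · have := hpos i
          rw [(Finset.mem_filter.mp hi).2] at this
          rw [Nat.mul_div_cancel _ (by omega)]

theorem MulEquiv.commutingTreeNumber_eq {H : Type*} [Group H] (e : G ≃* H) :
    commutingTreeNumber G = commutingTreeNumber H :=
  SimpleGraph.Iso.treeNumber_eq (⟨e.toEquiv, fun {x y} => by
    simp [commutingGraph, Commute, SemiconjBy, ← map_mul]⟩ : commutingGraph G ≃g commutingGraph H)

end group

open Matrix

/-! ### Trace fibres of `SL₂` and the roots of `X² - τ X + 1` -/

section conic

variable {F : Type*} [Field F]

/-- The number of roots of `X² - τ X + 1`. -/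
noncomputable def numRoots (τ : F) : ℕ := Nat.card {l : F // l ^ 2 - τ * l + 1 = 0}

/-- Every nonzero `l` is a root for exactly one `τ`, namely `l + l⁻¹`, and zero is never a root. -/
theorem sum_numRoots [Fintype F] : ∑ τ : F, numRoots τ = Nat.card F - 1 := by
  simp_rw [numRoots]
  rw [← Nat.card_sigma, ← card_ne_add_one (0 : F), Nat.add_sub_cancel]
  refine Nat.card_congr ⟨fun p => ⟨p.2.1, ?_⟩, fun l => ⟨l.1 + l.1⁻¹, l.1, ?_⟩, ?_, fun _ => rfl⟩
  · intro h
    simpa [h] using p.2.2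
  · have := l.2
    field_simp
    ring
  · rintro ⟨τ, l, hl⟩
    have h0 : l ≠ 0 := by
      rintro rfl
      simp at hl
    have : τ = l + l⁻¹ := by
      field_simp
      linear_combination -hl
    subst this
    rfl

theorem card_mul_eq [Fintype F] [DecidableEq F] (e : F) :
    Nat.card {p : F × F // p.1 * p.2 = e}
      = Nat.card F - 1 + if e = 0 then Nat.card F else 0 := by
  have e' : {p : F × F // p.1 * p.2 = e} ≃ Σ a : F, {b : F // a * b = e} :=
    ⟨fun p => ⟨p.1.1, p.1.2, p.2⟩, fun p => ⟨(p.1, p.2.1), p.2.2⟩, fun _ => rfl, fun _ => rfl⟩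
  rw [Nat.card_congr e', Nat.card_sigma, ← Finset.sum_erase_add _ _ (Finset.mem_univ 0)]
  congr 1
  · have h : ∀ a ∈ Finset.univ.erase (0 : F), Nat.card {b // a * b = e} = 1 := by
      intro a ha
      have ha := Finset.ne_of_mem_erase ha
      rw [Nat.card_eq_one_iff_exists]
      exact ⟨⟨e / a, mul_div_cancel₀ e ha⟩, fun b => Subtype.ext ((eq_div_iff ha).mpr
        (by rw [mul_comm, b.2]))⟩
    rw [Finset.sum_congr rfl h, Finset.sum_const, Finset.card_erase_of_mem (Finset.mem_univ _),
      Finset.card_univ, Nat.card_eq_fintype_card, smul_eq_mul, mul_one]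
  · by_cases he : e = 0
    · subst he
      simp
    · simp [he, Ne.symm he]

/-- The upper left entry `a` determines the diagonal, and the other two entries have product `a * (τ
- a) - 1`. This product is zero exactly at the roots `a` of the quadratic, where the number of
factorizations rises by `Nat.card F`. -/
theorem card_specialLinearGroup_trace [Finite F] (τ : F) :
    Nat.card {x : SpecialLinearGroup (Fin 2) F // trace x.1 = τ}
      = Nat.card F * (Nat.card F - 1 + numRoots τ) := by
  classical
  have := Fintype.ofFinite F
  have e : {x : SpecialLinearGroup (Fin 2) F // trace x.1 = τ} ≃
      Σ a : F, {p : F × F // p.1 * p.2 = a * (τ - a) - 1} :=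
    { toFun := fun x => ⟨x.1 0 0, (x.1 0 1, x.1 1 0), by
        have h1 := x.1.2
        have h2 := x.2
        rw [det_fin_two] at h1
        rw [trace_fin_two] at h2
        change x.1 0 1 * x.1 1 0 = x.1 0 0 * (τ - x.1 0 0) - 1
        linear_combination -h1 + x.1 0 0 * h2⟩
      invFun := fun p => ⟨⟨!![p.1, p.2.1.1; p.2.1.2, τ - p.1], by
        rw [det_fin_two_of]
        linear_combination -p.2.2⟩, by simp [trace_fin_two]⟩
      left_inv := by
        intro x
        have h2 := x.2
        rw [trace_fin_two] at h2
        ext i j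
        fin_cases i <;> fin_cases j <;> simp [← h2]
      right_inv := fun _ => rfl }
  rw [Nat.card_congr e, Nat.card_sigma]
  simp_rw [card_mul_eq]
  rw [Finset.sum_add_distrib, Finset.sum_const, Finset.card_univ, ← Nat.card_eq_fintype_card,
    ← Finset.sum_filter, Finset.sum_const, numRoots, Nat.card_eq_fintype_card (α := {l : F // _}),
    Fintype.card_subtype]
  simp_rw [show ∀ a, (a * (τ - a) - 1 = 0 ↔ a ^ 2 - τ * a + 1 = 0) from fun a =>
    ⟨fun h => by linear_combination -h, fun h => by linear_combination -h⟩]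
  simp only [smul_eq_mul]
  ring

theorem card_specialLinearGroup_fin_two [Finite F] :
    Nat.card (SpecialLinearGroup (Fin 2) F) = Nat.card F * (Nat.card F ^ 2 - 1) := by
  have := Fintype.ofFinite F
  rw [← Nat.card_congr (Equiv.sigmaFiberEquiv fun x : SpecialLinearGroup (Fin 2) F => trace x.1),
    Nat.card_sigma]
  simp_rw [card_specialLinearGroup_trace]
  rw [← Finset.mul_sum, Finset.sum_add_distrib, sum_numRoots, Finset.sum_const, Finset.card_univ,
    ← Nat.card_eq_fintype_card, smul_eq_mul]
  have : 1 ≤ Nat.card F := Nat.card_pos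
  obtain ⟨k, hk⟩ := Nat.exists_eq_add_of_le this
  rw [hk]
  congr 1
  have h : (1 + k) ^ 2 = (1 + k) * k + k + 1 := by ring
  rw [Nat.add_sub_cancel_left, h, Nat.add_sub_cancel]

variable [CharP F 2]

theorem sqrt_exists [Finite F] : ∃ r : F → F, (∀ a, r a ^ 2 = a) ∧ ∀ a b, a ^ 2 = b → a = r b := by
  have hinj : Function.Injective fun a : F => a ^ 2 := fun a b h => CharTwo.sq_injective h
  have hsurj := Finite.surjective_of_injective hinj
  exact ⟨Function.surjInv hsurj, Function.surjInv_eq hsurj, fun a b h =>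
    hinj (h.trans (Function.surjInv_eq hsurj b).symm)⟩

/-- Squaring is bijective, so each point of the projective line at which the form does not vanish
has exactly one representative of norm one. Of the `Nat.card F + 1` points, those lost are `(l : 1)`
with `l` a root; `none` stands for `(1 : 0)`. -/
theorem card_norm_eq_one [Finite F] (τ : F) :
    Nat.card {p : F × F // p.1 ^ 2 + τ * (p.1 * p.2) + p.2 ^ 2 = 1} + numRoots τ
      = Nat.card F + 1 := by
  classical
  have := Fintype.ofFinite F
  obtain ⟨r, hr, hr'⟩ := sqrt_exists (F := F)
  have e : Option {l : F // ¬ (l ^ 2 - τ * l + 1 = 0)} ≃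
      {p : F × F // p.1 ^ 2 + τ * (p.1 * p.2) + p.2 ^ 2 = 1} := by
    have h2 : (2 : F) = 0 := CharTwo.two_eq_zero
    have hne : ∀ l : F, ¬ (l ^ 2 - τ * l + 1 = 0) → r (l ^ 2 - τ * l + 1) ≠ 0 := by
      intro l hl h
      apply hl
      rw [← hr (l ^ 2 - τ * l + 1), h, zero_pow two_ne_zero]
    refine Equiv.ofBijective (fun o => o.elim ⟨(1, 0), by simp⟩ fun l =>
      ⟨(l.1 * (r (l.1 ^ 2 - τ * l.1 + 1))⁻¹, (r (l.1 ^ 2 - τ * l.1 + 1))⁻¹), ?_⟩) ⟨?_, ?_⟩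
    · have h := hr (l.1 ^ 2 - τ * l.1 + 1)
      have hi := inv_mul_cancel₀ (hne l.1 l.2)
      generalize r (l.1 ^ 2 - τ * l.1 + 1) = u at *
      linear_combination (u⁻¹ * u + 1) * hi - u⁻¹ ^ 2 * h + u⁻¹ ^ 2 * τ * l.1 * h2
    · rintro (_ | l) (_ | l') h
      · rfl
      · have := congrArg (fun p => p.1.2) h
        exact absurd this.symm (inv_ne_zero (hne l'.1 l'.2))
      · have := congrArg (fun p => p.1.2) h
        exact absurd this (inv_ne_zero (hne l.1 l.2))
      · have h1 : l.1 * (r (l.1 ^ 2 - τ * l.1 + 1))⁻¹ = l'.1 * (r (l'.1 ^ 2 - τ * l'.1 + 1))⁻¹ :=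
          congrArg (fun p => p.1.1) h
        have h2 : (r (l.1 ^ 2 - τ * l.1 + 1))⁻¹ = (r (l'.1 ^ 2 - τ * l'.1 + 1))⁻¹ :=
          congrArg (fun p => p.1.2) h
        rw [h2] at h1
        exact congrArg some (Subtype.ext
          (mul_right_cancel₀ (inv_ne_zero (hne l'.1 l'.2)) h1))
    · rintro ⟨⟨s, t⟩, h⟩
      simp only at h
      by_cases ht : t = 0
      · subst ht
        have hs : s = 1 := CharTwo.sq_injective (by simpa using h)
        subst hs
        exact ⟨none, rfl⟩
      · have hp : t⁻¹ ^ 2 = (s / t) ^ 2 - τ * (s / t) + 1 := by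
          field_simp
          linear_combination -h + τ * s * t * h2
        have hl : ¬ ((s / t) ^ 2 - τ * (s / t) + 1 = 0) := by
          rw [← hp]
          exact pow_ne_zero _ (inv_ne_zero ht)
        refine ⟨some ⟨s / t, hl⟩, Subtype.ext ?_⟩
        have := hr' _ _ hp
        simp only [Option.elim_some, ← this, inv_inv, div_mul_cancel₀ s ht]
  rw [← Nat.card_congr e, Finite.card_option, numRoots]
  have := Nat.card_congr (Equiv.sumCompl fun l : F => l ^ 2 - τ * l + 1 = 0)
  rw [Nat.card_sum] at this
  omega

theorem numRoots_zero : numRoots (0 : F) = 1 := by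
  rw [numRoots, Nat.card_eq_one_iff_exists]
  have h2 : (2 : F) = 0 := CharTwo.two_eq_zero
  refine ⟨⟨1, by linear_combination h2⟩, fun l => Subtype.ext (CharTwo.sq_injective ?_)⟩
  change l.1 ^ 2 = 1 ^ 2
  linear_combination l.2 - h2

/-- In characteristic two, a root `l` comes with the root `τ + l`, which differs from it when `τ ≠
0`. -/
theorem numRoots_eq {τ : F} (hτ : τ ≠ 0) : numRoots τ = 0 ∨ numRoots τ = 2 := by
  rcases isEmpty_or_nonempty {l : F // l ^ 2 - τ * l + 1 = 0} with h | ⟨l, hl⟩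
  · exact .inl Nat.card_of_isEmpty
  · right
    have h2 : (2 : F) = 0 := CharTwo.two_eq_zero
    have hset : {m : F | m ^ 2 - τ * m + 1 = 0} = {l, τ + l} := by
      ext m
      constructor
      · intro hm
        change m ^ 2 - τ * m + 1 = 0 at hm
        have : (m - l) * (m - (τ + l)) = 0 := by
          linear_combination hm - hl + (l ^ 2 - l * m) * h2
        rcases mul_eq_zero.mp this with h | h
        · exact .inl (sub_eq_zero.mp h)
        · exact .inr (sub_eq_zero.mp h)
      · rintro (rfl | rfl)
        · exact hl
        · change (τ + l) ^ 2 - τ * (τ + l) + 1 = 0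
          linear_combination hl + τ * l * h2
    have : numRoots τ = ({l, τ + l} : Set F).ncard := by
      rw [← hset, ← Nat.card_coe_set_eq]
      rfl
    rw [this, Set.ncard_pair (by simpa using hτ)]

end conic

/-! ### Centralizers in `SL₂` in characteristic two -/

section centralizer

variable {F : Type*} [Field F]

/-- Coordinates of the statement that two matrices of `SL₂` commute. -/
theorem commute_fin_two_iff (x y : SpecialLinearGroup (Fin 2) F) :
    Commute x y ↔ x 0 1 * y 1 0 = y 0 1 * x 1 0 ∧
      (x 0 0 - x 1 1) * y 0 1 = (y 0 0 - y 1 1) * x 0 1 ∧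
      (x 0 0 - x 1 1) * y 1 0 = (y 0 0 - y 1 1) * x 1 0 := by
  rw [Commute, SemiconjBy, Matrix.SpecialLinearGroup.ext_iff]
  simp only [Fin.forall_fin_two, Matrix.SpecialLinearGroup.coe_mul, mul_apply, Fin.sum_univ_two]
  constructor
  · rintro ⟨⟨h1, h2⟩, h3, h4⟩
    exact ⟨by linear_combination h1, by linear_combination h2, by linear_combination -h3⟩
  · rintro ⟨h1, h2, h3⟩
    exact ⟨⟨by linear_combination h1, by linear_combination h2⟩, by linear_combination -h3,
      by linear_combination -h1⟩

variable [CharP F 2]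

theorem eq_one_of_scalar {x : SpecialLinearGroup (Fin 2) F} (hb : x 0 1 = 0) (hc : x 1 0 = 0)
    (hd : x 0 0 - x 1 1 = 0) : x = 1 := by
  have hd : x 0 0 = x 1 1 := sub_eq_zero.mp hd
  have hdet := x.det_coe
  rw [det_fin_two, hb, hd] at hdet
  have h1 : x 1 1 = 1 := CharTwo.sq_injective (a₁ := x 1 1) (a₂ := 1) <| by
    linear_combination hdet
  refine Matrix.SpecialLinearGroup.ext _ _ fun i j => ?_
  fin_cases i <;> fin_cases j <;> simp [hb, hc, hd, h1]

/-- Commuting says that the vectors `(x 0 1, x 1 0, x 0 0 - x 1 1)` and its analogue for `y` have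
zero cross product. The first vector is nonzero, since only scalar matrices give zero and the sole
scalar matrix here is `1`. -/
theorem exists_eq_smul_add_of_commute {x y : SpecialLinearGroup (Fin 2) F} (hx : x ≠ 1)
    (h : Commute x y) : ∃ t : F, y 0 1 = t * x 0 1 ∧ y 1 0 = t * x 1 0 ∧
      y 0 0 - y 1 1 = t * (x 0 0 - x 1 1) := by
  obtain ⟨h1, h2, h3⟩ := (commute_fin_two_iff x y).mp h
  by_cases hb : x 0 1 = 0
  · by_cases hc : x 1 0 = 0
    · have hd : x 0 0 - x 1 1 ≠ 0 := by
        exact fun hd => hx (eq_one_of_scalar hb hc hd)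
      refine ⟨(y 0 0 - y 1 1) / (x 0 0 - x 1 1), ?_, ?_, ?_⟩ <;> field_simp
      · linear_combination h2
      · linear_combination h3
    · refine ⟨y 1 0 / x 1 0, ?_, ?_, ?_⟩ <;> field_simp
      · linear_combination -h1
      · linear_combination -h3
  · refine ⟨y 0 1 / x 0 1, ?_, ?_, ?_⟩ <;> field_simp
    · linear_combination h1
    · linear_combination -h2

theorem commute_trans {x y z : SpecialLinearGroup (Fin 2) F} (hy : y ≠ 1) (hxy : Commute x y)
    (hyz : Commute y z) : Commute x z := by
  obtain ⟨s, hs1, hs2, hs3⟩ := exists_eq_smul_add_of_commute hy hxy.symm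
  obtain ⟨t, ht1, ht2, ht3⟩ := exists_eq_smul_add_of_commute hy hyz
  rw [commute_fin_two_iff, hs1, hs2, hs3, ht1, ht2, ht3]
  refine ⟨?_, ?_, ?_⟩ <;> ring

/-- The matrices commuting with `x` are the combinations `s + t x`, and such a combination has
determinant `s² + trace x * s t + t²`; `card_norm_eq_one` counts those of determinant one. -/
theorem card_centralizer_add_numRoots [Finite F] {x : SpecialLinearGroup (Fin 2) F}
    (hx : x ≠ 1) :
    Nat.card (Subgroup.centralizer {x}) + numRoots (trace x.1) = Nat.card F + 1 := by
  rw [← card_norm_eq_one (trace x.1)]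
  have hdet := x.det_coe
  rw [det_fin_two] at hdet
  have hdetN : ∀ s t : F, (s • (1 : Matrix (Fin 2) (Fin 2) F) + t • x.1).det
      = s ^ 2 + trace x.1 * (s * t) + t ^ 2 := by
    intro s t
    rw [det_fin_two, trace_fin_two]
    simp
    linear_combination t ^ 2 * hdet
  let el : {p : F × F // p.1 ^ 2 + trace x.1 * (p.1 * p.2) + p.2 ^ 2 = 1} →
      Matrix.SpecialLinearGroup (Fin 2) F :=
    fun p => ⟨p.1.1 • 1 + p.1.2 • x.1, (hdetN _ _).trans p.2⟩
  have hmem : ∀ p, el p ∈ Subgroup.centralizer {x} := by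
    intro p
    refine Subgroup.mem_centralizer_singleton_iff.mpr (Subtype.ext ?_)
    change (p.1.1 • 1 + p.1.2 • x.1) * x.1 = x.1 * (p.1.1 • 1 + p.1.2 • x.1)
    simp [add_mul, mul_add]
  refine congrArg (· + _) (Nat.card_congr (Equiv.ofBijective (fun p =>
    (⟨el p, hmem p⟩ : Subgroup.centralizer {x})) ⟨?_, ?_⟩)).symm
  · rintro ⟨⟨s, t⟩, h⟩ ⟨⟨s', t'⟩, h'⟩ e
    have e : s • (1 : Matrix (Fin 2) (Fin 2) F) + t • x.1 = s' • 1 + t' • x.1 :=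
      congrArg (fun z => z.1.1) e
    have e00 := congrFun (congrFun e 0) 0
    have e01 := congrFun (congrFun e 0) 1
    have e10 := congrFun (congrFun e 1) 0
    have e11 := congrFun (congrFun e 1) 1
    simp at e00 e01 e10 e11
    have ht : t = t' := by
      by_contra hne
      refine hx (eq_one_of_scalar (e01.resolve_left hne) (e10.resolve_left hne) ?_)
      refine (mul_eq_zero.mp ?_).resolve_left (sub_ne_zero.mpr hne)
      linear_combination e00 - e11
    subst ht
    have hs : s = s' := by linear_combination e00
    subst hs
    rfl
  · rintro ⟨y, hy⟩
    rw [Subgroup.mem_centralizer_singleton_iff] at hy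
    obtain ⟨t, h1, h2, h3⟩ := exists_eq_smul_add_of_commute hx (show Commute x y from hy.symm)
    -- The off-diagonal entries and the diagonal difference fix `t`; the scalar part is then read
    -- off from the upper left entry.
    have he : (y 0 0 - t * x 0 0) • (1 : Matrix (Fin 2) (Fin 2) F) + t • x.1 = y.1 := by
      ext i j
      fin_cases i <;> fin_cases j <;> simp [h1, h2]
      linear_combination h3
    refine ⟨⟨(y 0 0 - t * x 0 0, t), ?_⟩, Subtype.ext (Subtype.ext he)⟩
    rw [← hdetN, he]
    exact y.2

end centralizer

/-! ### Counting centralizers by order -/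

section count

variable {F : Type*} [Field F]

theorem card_specialLinearGroup_numRoots [Finite F] (j : ℕ) :
    Nat.card {x : SpecialLinearGroup (Fin 2) F // numRoots (trace x.1) = j}
      = Nat.card {τ : F // numRoots τ = j} * (Nat.card F * (Nat.card F - 1 + j)) := by
  classical
  have := Fintype.ofFinite F
  have e : {x : SpecialLinearGroup (Fin 2) F // numRoots (trace x.1) = j} ≃
      Σ τ : {τ : F // numRoots τ = j}, {x : SpecialLinearGroup (Fin 2) F // trace x.1 = τ} :=
    ⟨fun x => ⟨⟨_, x.2⟩, ⟨x.1, rfl⟩⟩, fun p => ⟨p.2.1, by rw [p.2.2, p.1.2]⟩, fun _ => rfl,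
      by rintro ⟨⟨τ, hτ⟩, ⟨x, hx⟩⟩; change _ = τ at hx; subst hx; rfl⟩
  rw [Nat.card_congr e, Nat.card_sigma, Nat.card_eq_fintype_card (α := {τ : F // _}),
    ← Finset.card_univ]
  refine Finset.sum_const_nat fun τ _ => ?_
  rw [card_specialLinearGroup_trace, τ.2]

variable [CharP F 2]

theorem numRoots_eq_one_iff (τ : F) : numRoots τ = 1 ↔ τ = 0 := by
  constructor
  · intro h
    by_contra hτ
    have := numRoots_eq hτ
    omega
  · rintro rfl
    exact numRoots_zero

theorem numRoots_le_two (τ : F) : numRoots τ ≤ 2 := by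
  by_cases h : τ = 0
  · rw [h, numRoots_zero]
    exact one_le_two
  · have := numRoots_eq h
    omega

theorem card_numRoots_eq_one : Nat.card {τ : F // numRoots τ = 1} = 1 := by
  simp_rw [numRoots_eq_one_iff]
  exact Nat.card_unique

variable [Finite F]

/-- The root numbers add up to `Nat.card F - 1`, of which the trace `0` contributes one and every
other nonzero contribution is two. -/
theorem two_mul_card_numRoots_eq_two :
    2 * Nat.card {τ : F // numRoots τ = 2} + 2 = Nat.card F := by
  classical
  have := Fintype.ofFinite F
  have h1 := card_numRoots_eq_one (F := F)
  have hsum := sum_numRoots (F := F)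
  have hq : 1 < Nat.card F := Finite.one_lt_card
  have hite : ∀ τ : F, numRoots τ
      = (if numRoots τ = 1 then 1 else 0) + if numRoots τ = 2 then 2 else 0 := by
    intro τ
    have := numRoots_le_two τ
    interval_cases numRoots τ <;> rfl
  rw [Finset.sum_congr rfl fun τ _ => hite τ, Finset.sum_add_distrib, ← Finset.sum_filter,
    ← Finset.sum_filter, Finset.sum_const, Finset.sum_const, ← Fintype.card_subtype,
    ← Fintype.card_subtype, ← Nat.card_eq_fintype_card, ← Nat.card_eq_fintype_card, h1] at hsum
  simp only [smul_eq_mul] at hsum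
  omega

theorem two_mul_card_numRoots_eq_zero :
    2 * Nat.card {τ : F // numRoots τ = 0} = Nat.card F := by
  classical
  have := Fintype.ofFinite F
  have h1 := card_numRoots_eq_one (F := F)
  have h2 := two_mul_card_numRoots_eq_two (F := F)
  have h := Finset.card_eq_sum_card_fiberwise (f := numRoots) (s := (Finset.univ : Finset F))
    (t := Finset.range 3) fun τ _ => by
      have := numRoots_le_two τ
      simp
      omega
  simp only [Finset.sum_range_succ, Finset.sum_range_zero, ← Fintype.card_subtype,
    ← Nat.card_eq_fintype_card, Finset.card_univ] at h
  omega

/-- The number of nonidentity elements of `SL₂` with centralizer of order `m`. -/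
theorem card_centralizer_eq_of_ne {m j : ℕ} (hj : j ≠ 1) (hm : m + j = Nat.card F + 1) :
    Nat.card {x : {x : SpecialLinearGroup (Fin 2) F // x ≠ 1} //
        Nat.card (Subgroup.centralizer {x.1}) = m}
      = Nat.card {τ : F // numRoots τ = j} * (Nat.card F * (Nat.card F - 1 + j)) := by
  rw [← card_specialLinearGroup_numRoots, ← Nat.card_congr (Equiv.subtypeSubtypeEquivSubtype
    (p := fun x : SpecialLinearGroup (Fin 2) F => x ≠ 1)
    (q := fun x => numRoots (trace x.1) = j) ?_)]
  · refine Nat.card_congr (Equiv.subtypeEquivRight fun x => ?_)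
    have := card_centralizer_add_numRoots x.2
    omega
  -- The identity has trace `2 = 0`, hence root number one, so it is not among the matrices counted
  -- for `j ≠ 1`.
  · rintro x hx rfl
    apply hj
    rw [← hx, numRoots_eq_one_iff]
    simpa using CharTwo.two_eq_zero

/-- These elements are the matrices of trace zero other than the identity, which itself has trace
zero and accounts for the `+ 1`. -/
theorem card_centralizer_eq_card :
    Nat.card {x : {x : SpecialLinearGroup (Fin 2) F // x ≠ 1} //
        Nat.card (Subgroup.centralizer {x.1}) = Nat.card F} + 1 = Nat.card F ^ 2 := by
  have hq : 1 < Nat.card F := Finite.one_lt_card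
  have h := card_specialLinearGroup_numRoots (F := F) 1
  rw [card_numRoots_eq_one, one_mul, Nat.sub_add_cancel hq.le, ← sq] at h
  have h1 : numRoots (trace (1 : SpecialLinearGroup (Fin 2) F).1) = 1 := by
    rw [numRoots_eq_one_iff]
    simpa using CharTwo.two_eq_zero
  rw [← h, ← card_ne_add_one (⟨1, h1⟩ : {x : SpecialLinearGroup (Fin 2) F //
    numRoots (trace x.1) = 1})]
  refine congrArg (· + 1) (Nat.card_congr ⟨fun x => ⟨⟨x.1.1, ?_⟩, ?_⟩,
    fun x => ⟨⟨x.1.1, ?_⟩, ?_⟩, fun _ => rfl, fun _ => rfl⟩)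
  · have := card_centralizer_add_numRoots x.1.2
    have := x.2
    omega
  · exact fun h => x.1.2 (congrArg Subtype.val h)
  · exact fun h => x.2 (Subtype.ext h)
  · have h : Nat.card (Subgroup.centralizer {x.1.1}) + _ = _ :=
      card_centralizer_add_numRoots fun h => x.2 (Subtype.ext h)
    rw [x.1.2] at h
    exact Nat.succ_injective h

theorem commutingTreeNumber_specialLinearGroup {q : ℕ} (hq : Nat.card F = q) (h4 : 4 ≤ q) :
    commutingTreeNumber (SpecialLinearGroup (Fin 2) F) =
      q ^ ((q - 2) * (q + 1)) * (q - 1) ^ ((q - 3) * q * (q + 1) / 2) *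
        (q + 1) ^ ((q - 1) ^ 2 * q / 2) := by
  have hs : ∀ x : SpecialLinearGroup (Fin 2) F, x ≠ 1 →
      Nat.card (Subgroup.centralizer {x}) ∈ ({q, q - 1, q + 1} : Finset ℕ) := by
    intro x hx
    have h := card_centralizer_add_numRoots hx
    have h2 := numRoots_le_two (trace x.1)
    simp only [Finset.mem_insert, Finset.mem_singleton]
    omega
  have hM0 := two_mul_card_numRoots_eq_zero (F := F)
  have hM2 := two_mul_card_numRoots_eq_two (F := F)
  have hN := card_centralizer_eq_card (F := F)
  have hN2 := card_centralizer_eq_of_ne (F := F) (m := q - 1) (j := 2) (by decide) (by omega)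
  have hN0 := card_centralizer_eq_of_ne (F := F) (m := q + 1) (j := 0) (by decide) (by omega)
  rw [commutingTreeNumber_eq_prod (fun x y z => commute_trans) _ hs,
    Finset.prod_insert (by simp only [Finset.mem_insert, Finset.mem_singleton]; omega),
    Finset.prod_insert (by simp only [Finset.mem_singleton]; omega),
    Finset.prod_singleton, hN2, hN0]
  rw [hq] at *
  generalize Nat.card {τ : F // numRoots τ = 0} = k at *
  generalize Nat.card {τ : F // numRoots τ = 2} = l at *
  -- Writing `q = 2 l + 4`, with `l + 1` traces having two roots and `l + 2` having none, removes
  -- the halves and makes every natural-number division exact.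
  obtain ⟨l, rfl⟩ : ∃ l', l = l' + 1 := Nat.exists_eq_add_one.mpr (by omega)
  obtain rfl : k = l + 2 := by omega
  obtain rfl : q = 2 * l + 4 := by omega
  rw [mul_assoc]
  congr 3
  · have h : (2 * l + 4) ^ 2 = (2 * l + 4 + 1) * (2 * l + 4 - 1) + 1 := by
      rw [show 2 * l + 4 - 1 = 2 * l + 3 by omega]
      ring
    rw [Nat.succ_injective (hN.trans h), Nat.mul_div_cancel _ (by omega)]
  · rw [show (2 * l + 4 - 3) * (2 * l + 4) * (2 * l + 4 + 1)
        = 2 * ((2 * l + 4 - 3) * ((l + 2) * (2 * l + 5))) by ring,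
      Nat.mul_div_cancel_left _ two_pos, show 2 * l + 4 - 1 - 2 = 2 * l + 4 - 3 by omega,
      show 2 * l + 4 - 1 - 1 = 2 * (l + 1) by omega,
      show 2 * l + 4 - 1 + 2 = 2 * l + 5 by omega,
      show (l + 1) * ((2 * l + 4) * (2 * l + 5)) = 2 * (l + 1) * ((l + 2) * (2 * l + 5)) by ring,
      Nat.mul_div_cancel_left _ (by omega)]
  · rw [show (2 * l + 4 - 1) ^ 2 * (2 * l + 4) = 2 * ((2 * l + 4 - 1) ^ 2 * (l + 2)) by ring,
      Nat.mul_div_cancel_left _ two_pos, Nat.add_sub_cancel, add_zero,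
      show (l + 2) * ((2 * l + 4) * (2 * l + 4 - 1))
        = (2 * l + 4) * ((l + 2) * (2 * l + 4 - 1)) by ring,
      Nat.mul_div_cancel_left _ (by omega)]
    rw [show 2 * l + 4 + 1 - 2 = 2 * l + 4 - 1 by omega]
    ring

end count

/-! ### `PSL₂` over the fields of order 4 and 5, and the alternating group -/

section psl

/-- In characteristic two, `PSL₂ = SL₂`. -/
noncomputable def lTwoEquivOfCharTwo (F : Type*) [Field F] [CharP F 2] :
    LTwo F ≃* SpecialLinearGroup (Fin 2) F :=
  have h : Subgroup.center (SpecialLinearGroup (Fin 2) F) = ⊥ := by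
    rw [Subgroup.eq_bot_iff_forall]
    intro x hx
    obtain ⟨r, hr, hrx⟩ := Matrix.SpecialLinearGroup.mem_center_iff.mp hx
    rw [Fintype.card_fin] at hr
    have : r = 1 := CharTwo.sq_injective (by simpa using hr)
    subst this
    exact Subtype.ext (by rw [← hrx]; simp)
  (QuotientGroup.quotientMulEquivOfEq h).trans QuotientGroup.quotientBot

theorem charP_two_of_card {F : Type*} [Field F] {n : ℕ} (h : Nat.card F = 2 ^ n) : CharP F 2 := by
  have : Finite F := Nat.finite_of_card_ne_zero (by rw [h]; positivity)
  have := Fintype.ofFinite F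
  obtain ⟨p, hp⟩ := CharP.exists F
  obtain ⟨k, hpp, hk⟩ := FiniteField.card F p
  rw [← Nat.card_eq_fintype_card, h] at hk
  have h2 : p ∣ 2 ^ n := hk ▸ dvd_pow_self p k.2.ne'
  have := (Nat.prime_dvd_prime_iff_eq hpp Nat.prime_two).mp (hpp.dvd_of_dvd_pow h2)
  exact this ▸ hp

theorem nonempty_mulEquiv_alternatingGroup {G X : Type*} [Group G] (φ : G →* Equiv.Perm X)
    (hφ : Function.Injective φ) {n : ℕ} (hX : Nat.card X = n) (hn : 2 ≤ n)
    (hG : 2 * Nat.card G = n.factorial) : Nonempty (G ≃* alternatingGroup (Fin n)) := by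
  have : Finite X := Nat.finite_of_card_ne_zero (by omega)
  have e : X ≃ Fin n := Finite.equivFinOfCardEq hX
  let ψ : G →* Equiv.Perm (Fin n) := (e.permCongrHom : _ →* _).comp φ
  have hψ : Function.Injective ψ := e.permCongrHom.injective.comp hφ
  have hcard : Nat.card ψ.range = Nat.card G :=
    Nat.card_congr (MonoidHom.ofInjective hψ).symm.toEquiv
  have hindex : ψ.range.index = 2 := by
    have h := ψ.range.card_mul_index
    rw [hcard, Nat.card_perm, Nat.card_fin, ← hG, mul_comm 2] at h
    exact Nat.eq_of_mul_eq_mul_left (by have := n.factorial_pos; omega) h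
  have := Equiv.Perm.eq_alternatingGroup_of_index_eq_two hindex
  exact ⟨(MonoidHom.ofInjective hψ).trans (MulEquiv.subgroupCongr this)⟩

theorem lTwo_four_equiv (F : Type*) [Field F] (hF : Nat.card F = 4) :
    Nonempty (LTwo F ≃* alternatingGroup (Fin 5)) := by
  have : CharP F 2 := charP_two_of_card (n := 2) hF
  have : Finite F := Nat.finite_of_card_ne_zero (by omega)
  refine nonempty_mulEquiv_alternatingGroup Projectivization.PSLAction.toPermHom
    Matrix.ProjectiveSpecialLinearGroup.toPermHom_injective (n := 5) ?_ (by decide) ?_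
  · rw [Projectivization.card_of_finrank_two _ _ (by simp), hF]
  · rw [Nat.card_congr (lTwoEquivOfCharTwo F).toEquiv, card_specialLinearGroup_fin_two, hF]
    rfl

/-- A set of trace zero elements of `SL₂(5)`: together with `±1` it is a quaternion group. -/
def quaternionList : List (SpecialLinearGroup (Fin 2) (ZMod 5)) :=
  [⟨!![2, 0; 0, 3], by decide⟩, ⟨!![3, 0; 0, 2], by decide⟩, ⟨!![0, 1; 4, 0], by decide⟩,
    ⟨!![0, 4; 1, 0], by decide⟩, ⟨!![0, 2; 2, 0], by decide⟩, ⟨!![0, 3; 3, 0], by decide⟩]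

/-- The normalizer of a quaternion group in `SL₂(5)`. -/
def binaryTetrahedral : Subgroup (SpecialLinearGroup (Fin 2) (ZMod 5)) :=
  Subgroup.normalizer {x | x ∈ quaternionList}

theorem card_binaryTetrahedral : Nat.card binaryTetrahedral = 24 := by
  have h : ∀ x, x ∈ binaryTetrahedral ↔ ∀ y ∈ quaternionList,
      x * y * x⁻¹ ∈ quaternionList ∧ x⁻¹ * y * x ∈ quaternionList := by
    intro x
    rw [binaryTetrahedral, Subgroup.mem_set_normalizer_iff]
    refine ⟨fun h y hy => ⟨(h y).mp hy, (h _).mpr ?_⟩,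
      fun h y => ⟨fun hy => (h y hy).1, fun hy => ?_⟩⟩
    · change x * (x⁻¹ * y * x) * x⁻¹ ∈ quaternionList
      convert hy using 1
      group
    · have := (h _ hy).2
      change y ∈ quaternionList
      convert this using 1
      group
  -- The normalizer condition is now a test on six matrices, hence decidable, and the elements can
  -- be counted by evaluation.
  rw [Nat.card_congr (Equiv.subtypeEquivRight h), Nat.card_eq_fintype_card]
  decide +kernel

instance : Fact (Nat.Prime 5) := ⟨Nat.prime_five⟩

theorem card_lTwo_zmod_five : Nat.card (LTwo (ZMod 5)) = 60 := by
  have h := (Subgroup.center (SpecialLinearGroup (Fin 2) (ZMod 5))).card_mul_index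
  rw [card_specialLinearGroup_fin_two, Nat.card_zmod, Nat.card_congr
    (Matrix.SpecialLinearGroup.center_equiv_rootsOfUnity (n := Fin 2) (R := ZMod 5)).toEquiv] at h
  have h2 : Nat.card (rootsOfUnity (max (Fintype.card (Fin 2)) 1) (ZMod 5)) = 2 := by
    exact (IsPrimitiveRoot.neg_one 5 (by decide)).card_rootsOfUnity
  rw [h2] at h
  change Subgroup.index _ = 60
  omega

theorem center_le_ker_toPermHom_quotient {G : Type*} [Group G] {H : Subgroup G}
    (h : Subgroup.center G ≤ H) : Subgroup.center G ≤ (MulAction.toPermHom G (G ⧸ H)).ker := by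
  rw [← Subgroup.normalCore_eq_ker]
  exact Subgroup.normal_le_normalCore.mpr h

/-- The index is `120 / 24 = 5`. The centre acts trivially on the five cosets, and by simplicity the
induced action is faithful unless it is trivial, which would force the subgroup to be the whole
group. -/
theorem lTwo_zmod_five_equiv : Nonempty (LTwo (ZMod 5) ≃* alternatingGroup (Fin 5)) := by
  have hindex : binaryTetrahedral.index = 5 := by
    have h := binaryTetrahedral.card_mul_index
    rw [card_specialLinearGroup_fin_two, Nat.card_zmod, card_binaryTetrahedral] at h
    omega
  have : IsSimpleGroup (LTwo (ZMod 5)) :=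
    Matrix.ProjectiveSpecialLinearGroup.rank_two_simple (by rw [Nat.card_zmod]; decide)
  let φ : LTwo (ZMod 5) →* Equiv.Perm (SpecialLinearGroup (Fin 2) (ZMod 5) ⧸ binaryTetrahedral) :=
    QuotientGroup.lift _ (MulAction.toPermHom _ _)
      (center_le_ker_toPermHom_quotient (Subgroup.center_le_normalizer _))
  refine nonempty_mulEquiv_alternatingGroup φ ?_ hindex (by decide) ?_
  · rw [← MonoidHom.ker_eq_bot_iff]
    refine (inferInstance : φ.ker.Normal).eq_bot_or_eq_top.resolve_right fun htop => ?_
    have : binaryTetrahedral = ⊤ := by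
      rw [← top_le_iff, ← Subgroup.normal_le_normalCore, Subgroup.normalCore_eq_ker]
      intro x _
      exact (htop ▸ Subgroup.mem_top (x : LTwo (ZMod 5)) : (x : LTwo (ZMod 5)) ∈ φ.ker)
    rw [this, Subgroup.index_top] at hindex
    omega
  · rw [card_lTwo_zmod_five]
    rfl

/-- An isomorphism of fields induces an isomorphism of the groups `PSL₂`. -/
theorem nonempty_lTwo_congr {F K : Type*} [Field F] [Field K] (e : F ≃+* K) :
    Nonempty (LTwo F ≃* LTwo K) := by
  let f : SpecialLinearGroup (Fin 2) F ≃* SpecialLinearGroup (Fin 2) K :=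
    { Matrix.SpecialLinearGroup.map e.toRingHom with
      invFun := Matrix.SpecialLinearGroup.map e.symm.toRingHom
      left_inv := fun x => by ext; simp
      right_inv := fun x => by ext; simp }
  refine ⟨QuotientGroup.congr _ _ f ?_⟩
  ext x
  constructor
  · rintro ⟨y, hy, rfl⟩
    refine Subgroup.mem_center_iff.mpr fun z => ?_
    obtain ⟨z, rfl⟩ := f.surjective z
    exact (map_mul f _ _).symm.trans
      ((congrArg f (Subgroup.mem_center_iff.mp hy z)).trans (map_mul f _ _))
  · intro hx
    refine ⟨f.symm x, Subgroup.mem_center_iff.mpr fun z => f.injective ?_, f.apply_symm_apply x⟩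
    rw [map_mul, map_mul, f.apply_symm_apply]
    exact Subgroup.mem_center_iff.mp hx _

theorem lTwo_five_equiv (F : Type*) [Field F] (hF : Nat.card F = 5) :
    Nonempty (LTwo F ≃* alternatingGroup (Fin 5)) := by
  have : Finite F := Nat.finite_of_card_ne_zero (by omega)
  have := Fintype.ofFinite F
  obtain ⟨e⟩ := nonempty_lTwo_congr
    (ZMod.ringEquivOfPrime F Nat.prime_five (by rw [← Nat.card_eq_fintype_card, hF])).symm
  obtain ⟨e'⟩ := lTwo_zmod_five_equiv
  exact ⟨e.trans e'⟩

theorem commutingTreeNumber_lTwo {n q : ℕ} (hn : 2 ≤ n) (hq : q = 2 ^ n) (F : Type*) [Field F]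
    (hF : Nat.card F = q) :
    commutingTreeNumber (LTwo F) =
      q ^ ((q - 2) * (q + 1)) * (q - 1) ^ ((q - 3) * q * (q + 1) / 2) *
        (q + 1) ^ ((q - 1) ^ 2 * q / 2) := by
  have h4 : 4 ≤ q := hq ▸ Nat.pow_le_pow_right two_pos hn
  have : Finite F := Nat.finite_of_card_ne_zero (by omega)
  have : CharP F 2 := charP_two_of_card (hF.trans hq)
  rw [(lTwoEquivOfCharTwo F).commutingTreeNumber_eq,
    commutingTreeNumber_specialLinearGroup hF h4]

theorem commutingTreeNumber_alternatingGroup_five :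
    commutingTreeNumber (alternatingGroup (Fin 5)) = 2 ^ 20 * 3 ^ 10 * 5 ^ 18 := by
  -- The general formula applies only to even `q`, so the value is obtained from the field of order
  -- 4.
  have hF : Nat.card (GaloisField 2 2) = 4 := GaloisField.card 2 2 two_ne_zero
  obtain ⟨e⟩ := lTwo_four_equiv (GaloisField 2 2) hF
  rw [← e.commutingTreeNumber_eq, commutingTreeNumber_lTwo le_rfl rfl _ hF]
  norm_num

end psl

theorem mainTheorem4 :
    (∀ (n q : ℕ), 2 ≤ n → q = 2 ^ n →
      ∀ (F : Type*) [Field F], Nat.card F = q →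
        commutingTreeNumber (LTwo F) =
          q ^ ((q - 2) * (q + 1)) * (q - 1) ^ ((q - 3) * q * (q + 1) / 2) *
            (q + 1) ^ ((q - 1) ^ 2 * q / 2)) ∧
    (∀ (F₄ : Type*) [Field F₄] (F₅ : Type*) [Field F₅], Nat.card F₄ = 4 → Nat.card F₅ = 5 →
      Nonempty (LTwo F₄ ≃* LTwo F₅) ∧
      Nonempty (LTwo F₅ ≃* alternatingGroup (Fin 5)) ∧
      commutingTreeNumber (LTwo F₅) = 2 ^ 20 * 3 ^ 10 * 5 ^ 18 ∧
      commutingTreeNumber (alternatingGroup (Fin 5)) = 2 ^ 20 * 3 ^ 10 * 5 ^ 18) := by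
  refine ⟨fun n q hn hq F _ hF => commutingTreeNumber_lTwo hn hq F hF,
    fun F₄ _ F₅ _ h4 h5 => ?_⟩
  obtain ⟨e₄⟩ := lTwo_four_equiv F₄ h4
  obtain ⟨e₅⟩ := lTwo_five_equiv F₅ h5
  exact ⟨⟨e₄.trans e₅.symm⟩, ⟨e₅⟩,
    e₅.commutingTreeNumber_eq.trans commutingTreeNumber_alternatingGroup_five,
    commutingTreeNumber_alternatingGroup_five⟩
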